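/- Let $X$ be a ($0$-dimensional) Polish space, $d$ an ultrametric on $X$ compatible with the topology, and $\mu$ a Borel probability measure on $X$. Let $T:X\to X$ be a Borel bijection that is nonsingular (i.e. the measure $\mu\circ T: A\mapsto \mu(TA)$ is equivalent to $\mu$) and conservative (i.e. every Borel set $B$ with $\mu(B)>0$ contains a point $x$ with $T^m x\in B$ for some $m\ge 1$). Let $\mathcal R\subset X\times X$ be a countable Borel equivalence relation (a Borel set all of whose classes $\mathcal R(x)$ are countable), and let $\mathrm{Inv}(\mathcal R)$ be the $\sigma$-algebra of Borel sets that are unions of $\mathcal R$-classes. Suppose that 1. $T$ normalizes $\mathcal R$: $T(\mathcal R(x))=\mathcal R(Tx)$ for every $x\in X$; 2. the restriction of $T$ to $\mathrm{Inv}(\mathcal R)$ is $\mu$-ergodic: every $B\in\mathrm{Inv}(\mathcal R)$ with $T^{-1}B=B$ is $\mu$-null or $\mu$-conull; 3. $T$ is strictly $\mathcal R$-outer: for each $n\in\mathbb Z\setminus\{0\}$, $T^nx\notin\mathcal R(x)$ for $\mu$-a.e. $x$; 4. $T$ squashes $\mathcal R$: there is a $\mu$-conull set $X_1\subset X$ such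 that $\lim_{|n|\to\infty}d(T^nx,T^ny)=0$ for all $(x,y)\in\mathcal R\cap(X_1\times X_1)$; 5. there are a Borel map $\alpha:\mathcal R\to[1,+\infty)$ and a $\mu$-conull Borel set $X_0\subset X$ such that $$\alpha(x,y)^{-1}<\frac{d\mu\circ T^{-k}}{d\mu}(x)\Big/\frac{d\mu\circ T^{-k}}{d\mu}(y)<\alpha(x,y)$$ for all $(x,y)\in\mathcal R\cap(X_0\times X_0)$ and all integers $k\ge 0$. Then $T$ is ergodic: every Borel set $B$ with $T^{-1}B=B$ is $\mu$-null or $\mu$-conull. If, moreover, $\mathcal R$ is $\mu$-ergodic (every set in $\mathrm{Inv}(\mathcal R)$ is $\mu$-null or $\mu$-conull), then $T$ is weakly mixing: for every standard probability space $(Y,\nu)$ and every ergodic $\nu$-preserving invertible transformation $S$ of $(Y,\nu)$, the product $T\times S$ is ergodic on $(X\times Y,\mu\times\nu)$. -/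

import Mathlib

open MeasureTheory Filter Topology

universe u v

namespace NonsingularDynamics

/-- The power `T ^ n` (`n : ℤ`) of an invertible Borel transformation `T`, as a map. -/
def power {X : Type u} [MeasurableSpace X] (T : X ≃ᵐ X) (n : ℤ) : X → X :=
  ((T.toEquiv : Equiv.Perm X) ^ n : Equiv.Perm X)

/-- `T` is a nonsingular transformation of `(X, μ)`: the measure `μ ∘ T : A ↦ μ (T A)`
is equivalent to `μ`. -/
def IsNonsingular {X : Type u} [MeasurableSpace X] (T : X ≃ᵐ X) (μ : Measure X) : Prop :=
  μ.comap T ≪ μ ∧ μ ≪ μ.comap T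

/-- The Radon-Nikodym derivative `d(μ ∘ T ^ n) / dμ`, where `(μ ∘ T ^ n) A = μ (T ^ n A)`. -/
noncomputable def derivPower {X : Type u} [MeasurableSpace X] (T : X ≃ᵐ X) (μ : Measure X)
    (n : ℤ) (x : X) : ℝ :=
  ((μ.comap (power T n)).rnDeriv μ x).toReal

/-- A countable Borel equivalence relation: a Borel subset of `X × X` with countable classes. -/
structure IsCountableBorel {X : Type u} [MeasurableSpace X] (R : Setoid X) : Prop where
  measurableSet_graph : MeasurableSet {p : X × X | R p.1 p.2}
  countable_class : ∀ x, {y | R x y}.Countable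

/-- `T` normalizes `R`: `T (R(x)) = R(T x)` for every `x`. -/
def Normalizes {X : Type u} [MeasurableSpace X] (T : X ≃ᵐ X) (R : Setoid X) : Prop :=
  ∀ x, T '' {y | R x y} = {y | R (T x) y}

/-- The members of `Inv(R)`: the Borel sets that are unions of `R`-classes. -/
def IsInv {X : Type u} [MeasurableSpace X] (R : Setoid X) (B : Set X) : Prop :=
  MeasurableSet B ∧ ∀ x ∈ B, ∀ y, R x y → y ∈ B

/-- `R` is `μ`-ergodic: each member of `Inv(R)` is `μ`-null or `μ`-conull. -/
def IsErgodicRel {X : Type u} [MeasurableSpace X] (R : Setoid X) (μ : Measure X) : Prop :=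
  ∀ B, IsInv R B → μ B = 0 ∨ μ Bᶜ = 0

/-- The restriction of `T` to `Inv(R)` is `μ`-ergodic: each `T`-invariant member of `Inv(R)` is
`μ`-null or `μ`-conull. -/
def IsErgodicOnInv {X : Type u} [MeasurableSpace X] (T : X ≃ᵐ X) (R : Setoid X)
    (μ : Measure X) : Prop :=
  ∀ B, IsInv R B → T ⁻¹' B = B → μ B = 0 ∨ μ Bᶜ = 0

/-- `T` is strictly `R`-outer (mod `μ`): for `n ≠ 0`, `T ^ n x` is not `R`-equivalent to `x`, for
almost every `x`. -/
def IsStrictlyOuter {X : Type u} [MeasurableSpace X] (T : X ≃ᵐ X) (R : Setoid X)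
    (μ : Measure X) : Prop :=
  ∀ n : ℤ, n ≠ 0 → ∀ᵐ x ∂μ, ¬ R x (power T n x)

/-- `T` squashes `R`: on a conull set, `d (T ^ n x, T ^ n y) → 0` as `n → ∞` in the discrete
group `ℤ` (that is, as `|n| → ∞`), for all `R`-equivalent `x`, `y`. -/
def Squashes {X : Type u} [MetricSpace X] [MeasurableSpace X] (T : X ≃ᵐ X) (R : Setoid X)
    (μ : Measure X) : Prop :=
  ∃ X₀ : Set X, μ X₀ᶜ = 0 ∧ ∀ x ∈ X₀, ∀ y ∈ X₀, R x y →
    Tendsto (fun n : ℤ => dist (power T n x) (power T n y)) cofinite (𝓝 0)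

/-- The one-sided boundedness condition: the ratios of the Radon-Nikodym derivatives of
`μ ∘ T ^ (-k)`, `k ≥ 0`, at `R`-equivalent points of a conull Borel set lie strictly between
`α⁻¹` and `α`, for a Borel map `α : R → [1, ∞)` that does not depend on `k`. -/
def IsBackwardBounded {X : Type u} [MeasurableSpace X] (T : X ≃ᵐ X) (R : Setoid X)
    (μ : Measure X) : Prop :=
  ∃ (α : {p : X × X // R p.1 p.2} → ℝ) (X₀ : Set X),
    Measurable α ∧ (∀ p, 1 ≤ α p) ∧ MeasurableSet X₀ ∧ μ X₀ᶜ = 0 ∧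
    ∀ x ∈ X₀, ∀ y ∈ X₀, ∀ h : R x y, ∀ k : ℕ,
      (α ⟨(x, y), h⟩)⁻¹ < derivPower T μ (-(k : ℤ)) x / derivPower T μ (-(k : ℤ)) y ∧
      derivPower T μ (-(k : ℤ)) x / derivPower T μ (-(k : ℤ)) y < α ⟨(x, y), h⟩

/-- `T` is weakly mixing: the product of `T` with every ergodic measure preserving invertible
transformation of a standard probability space is ergodic. -/
def IsWeaklyMixing {X : Type u} [MeasurableSpace X] (T : X ≃ᵐ X) (μ : Measure X) : Prop :=
  ∀ (Y : Type v) [MeasurableSpace Y] [StandardBorelSpace Y] (ν : Measure Y)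
    [IsProbabilityMeasure ν] (S : Y ≃ᵐ Y),
    Ergodic S ν → QuasiErgodic (Prod.map T S) (μ.prod ν)

end NonsingularDynamics

/-!
The proof is Hopf's argument, carried out for the nonsingular map `T⁻¹ × S⁻¹`, where `S` preserves
a probability measure `ν` (for the ergodicity of `T` itself, `S` is the identity of a point).

Let `w = d(μ ∘ T⁻¹)/dμ`, let `W k = d(μ ∘ T⁻ᵏ)/dμ` be the product of `w` along the first `k` points
of the backward orbit, and let `B ⊆ X × Y` be invariant. Hopf's maximal inequality
(`measure_weightedSum_gt_le`) bounds the set where the `W`-weighted backward averages of `|f - 1_B|`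
are ever large by the integral of `|f - 1_B|`. As the averages of `1_B` are `1_B` itself, no
pointwise ratio ergodic theorem is needed: choosing uniformly continuous `f j` that converge to
`1_B` fast in mean and applying Borel-Cantelli, at almost every point all averages of `f j` are
within `2⁻ʲ` of `1_B` once `j` is large (`exists_approx_weightedSum`). For `R`-equivalent `x`, `x'`
the values of `f j` along the backward orbits of `(x, y)` and `(x', y)` become asymptotic since `T`
squashes `R`, the weights at `x` and `x'` agree up to a bounded factor, and their sum diverges
since `T` is conservative (`ae_tendsto_sum_cocycleProd_atTop`). Hence the averages at the two points
cannot be near `1` and near `0` (`not_tendsto_sum_of_comparable`): off a null set, the fibres of `B`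
over `Y` are `R`-invariant (`exists_conull_forall_rel_mem`).

Lusin's separation theorem turns this into a genuine member of `Inv(R)` that agrees almost
everywhere with the fibre (`exists_isInv_separating`, `ae_fiber_ae_eq_isInv`). If `Y` is a point,
this member can be made `T`-invariant as well, because `T` normalizes `R`, and ergodicity of `T` on
`Inv(R)` applies. If `R` is ergodic, almost every fibre of `B` is null or conull, and the set of
those `y` with null fibre is `S`-invariant, so it is null or conull.
-/

namespace NonsingularDynamics
open scoped NNReal ENNReal

/-! ### The maximal inequality for weighted orbit sums -/

/-- The product `w z * w (V z) * ⋯ * w (V^[k-1] z)` of the weight `w` along an orbit of `V`. -/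
def cocycleProd {Z : Type*} (V : Z → Z) (w : Z → ℝ≥0) (k : ℕ) (z : Z) : ℝ≥0 :=
  ∏ i ∈ Finset.range k, w (V^[i] z)

theorem cocycleProd_succ {Z : Type*} (V : Z → Z) (w : Z → ℝ≥0) (k : ℕ) (z : Z) :
    cocycleProd V w (k + 1) z = w z * cocycleProd V w k (V z) := by
  simp [cocycleProd, Finset.prod_range_succ', mul_comm]

/-- The weighted sum of the first `n` values of `g` along the orbit of `z`, that is, the sum of the
first `n` iterates of the transfer operator `g ↦ w * (g ∘ V)`, applied to `g`. -/
def weightedSum {Z : Type*} (V : Z → Z) (w : Z → ℝ≥0) (g : Z → ℝ) (n : ℕ) (z : Z) : ℝ :=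
  ∑ k ∈ Finset.range n, (cocycleProd V w k z : ℝ) * g (V^[k] z)

theorem weightedSum_succ {Z : Type*} (V : Z → Z) (w : Z → ℝ≥0) (g : Z → ℝ) (n : ℕ) (z : Z) :
    weightedSum V w g (n + 1) z = g z + w z * weightedSum V w g n (V z) := by
  rw [weightedSum, Finset.sum_range_succ', weightedSum, Finset.mul_sum, add_comm]
  congr 1
  · simp [cocycleProd]
  · refine Finset.sum_congr rfl fun k _ => ?_
    rw [cocycleProd_succ, Function.iterate_succ_apply]
    push_cast
    ring

/-- The maximum of `0` and the weighted sums of `f` of lengths `1, …, n`, by the recursion that it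
satisfies because the transfer operator is positive. -/
def maxWeightedSum {Z : Type*} (V : Z → Z) (w : Z → ℝ≥0) (f : Z → ℝ) : ℕ → Z → ℝ
  | 0 => fun _ => 0
  | n + 1 => fun z => max 0 (f z + w z * maxWeightedSum V w f n (V z))

section Order

variable {Z : Type*} (V : Z → Z) (w : Z → ℝ≥0) (f : Z → ℝ)

theorem maxWeightedSum_nonneg (n : ℕ) (z : Z) : 0 ≤ maxWeightedSum V w f n z := by
  cases n with
  | zero => exact le_rfl
  | succ n => exact le_max_left _ _

theorem maxWeightedSum_le_succ (n : ℕ) (z : Z) :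
    maxWeightedSum V w f n z ≤ maxWeightedSum V w f (n + 1) z := by
  induction n generalizing z with
  | zero => exact maxWeightedSum_nonneg V w f 1 z
  | succ n ih =>
    exact max_le_max le_rfl (by have := ih (V z); gcongr)

theorem maxWeightedSum_mono (z : Z) : Monotone fun n => maxWeightedSum V w f n z :=
  monotone_nat_of_le_succ fun n => maxWeightedSum_le_succ V w f n z

theorem weightedSum_le_maxWeightedSum (n : ℕ) (z : Z) :
    weightedSum V w f n z ≤ maxWeightedSum V w f n z := by
  induction n generalizing z with
  | zero => simp [weightedSum, maxWeightedSum]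
  | succ n ih =>
    rw [weightedSum_succ]
    refine le_max_of_le_right ?_
    have := ih (V z)
    gcongr

theorem weightedSum_sub_const (g : Z → ℝ) (c : ℝ) (n : ℕ) (z : Z) :
    weightedSum V w (fun z => g z - c) n z
      = weightedSum V w g n z - c * weightedSum V w (fun _ => 1) n z := by
  simp only [weightedSum, Finset.mul_sum, ← Finset.sum_sub_distrib]
  exact Finset.sum_congr rfl fun k _ => by ring

end Order

section Maximal

variable {Z : Type*} [MeasurableSpace Z] {m : Measure Z} {V : Z → Z} {w : Z → ℝ≥0}

/-- The hypothesis `hVw` says that `w` is the density of the image of `m` under the inverse of `V`,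
without naming an inverse; it makes `g ↦ w * (g ∘ V)` preserve integrals. -/
theorem integrable_transfer (hV : Measurable V) (hw : Measurable w)
    (hVw : (m.withDensity fun z => w z).map V = m) {g : Z → ℝ} (hg : Integrable g m) :
    Integrable (fun z => (w z : ℝ) * g (V z)) m := by
  rw [← hVw] at hg
  have h := (integrable_withDensity_iff_integrable_smul hw).1 (hg.comp_measurable hV)
  simpa [NNReal.smul_def] using h

theorem integral_transfer (hV : Measurable V) (hw : Measurable w)
    (hVw : (m.withDensity fun z => w z).map V = m) {g : Z → ℝ} (hg : Integrable g m) :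
    ∫ z, (w z : ℝ) * g (V z) ∂m = ∫ z, g z ∂m := by
  rw [← hVw] at hg
  conv_rhs => rw [← hVw]
  rw [integral_map hV.aemeasurable hg.aestronglyMeasurable,
    integral_withDensity_eq_integral_smul hw]
  simp [NNReal.smul_def]

theorem measurable_maxWeightedSum (hV : Measurable V) (hw : Measurable w) {f : Z → ℝ}
    (hf : Measurable f) (n : ℕ) : Measurable (maxWeightedSum V w f n) := by
  induction n with
  | zero => exact measurable_const
  | succ n ih =>
    exact measurable_const.max
      (hf.add (hw.coe_nnreal_real.mul (ih.comp hV)))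

theorem integrable_maxWeightedSum (hV : Measurable V) (hw : Measurable w)
    (hVw : (m.withDensity fun z => w z).map V = m) {f : Z → ℝ} (hf : Integrable f m) (n : ℕ) :
    Integrable (maxWeightedSum V w f n) m := by
  induction n with
  | zero => exact integrable_zero _ _ _
  | succ n ih =>
    exact (integrable_zero _ _ _).sup (hf.add (integrable_transfer hV hw hVw ih))

/-- Hopf's maximal ergodic lemma, with Garsia's proof: where the maximum `M` is positive it
satisfies `M ≤ f + w * (M ∘ V)`, and `M` and `w * (M ∘ V)` have the same integral. -/
theorem setIntegral_maxWeightedSum_pos_nonneg (hV : Measurable V) (hw : Measurable w)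
    (hVw : (m.withDensity fun z => w z).map V = m) {f : Z → ℝ} (hfm : Measurable f)
    (hf : Integrable f m) (n : ℕ) :
    0 ≤ ∫ z in {z | 0 < maxWeightedSum V w f n z}, f z ∂m := by
  cases n with
  | zero => simp [maxWeightedSum]
  | succ n =>
    set M := maxWeightedSum V w f (n + 1) with hM
    have hMi : Integrable M m := integrable_maxWeightedSum hV hw hVw hf _
    have hE : MeasurableSet {z | 0 < M z} :=
      measurableSet_lt measurable_const (measurable_maxWeightedSum hV hw hfm _)
    have hU := integrable_transfer hV hw hVw hMi
    have key : ∀ z, M z - w z * M (V z) ≤ {z | 0 < M z}.indicator f z := by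
      intro z
      have hMV : 0 ≤ M (V z) := maxWeightedSum_nonneg _ _ _ _ _
      by_cases hz : 0 < M z
      · rw [Set.indicator_of_mem (by exact hz)]
        have h1 : M z = max 0 (f z + w z * maxWeightedSum V w f n (V z)) := rfl
        have h2 : M z = f z + w z * maxWeightedSum V w f n (V z) := by
          rcases max_choice 0 (f z + w z * maxWeightedSum V w f n (V z)) with h | h
          · exact absurd (h1.trans h) hz.ne'
          · exact h1.trans h
        have h3 : (w z : ℝ) * maxWeightedSum V w f n (V z) ≤ w z * M (V z) := by
          have := maxWeightedSum_le_succ V w f n (V z)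
          gcongr
        linarith
      · rw [Set.indicator_of_notMem (by exact hz)]
        have : 0 ≤ (w z : ℝ) * M (V z) := by positivity
        linarith
    rw [← integral_indicator hE]
    calc (0 : ℝ) = ∫ z, (M z - w z * M (V z)) ∂m := by
          rw [integral_sub hMi hU, integral_transfer hV hw hVw hMi, sub_self]
      _ ≤ _ := integral_mono (hMi.sub hU) (hf.indicator hE) key

/-- The maximal inequality: the weighted averages of `g ≥ 0` ever exceed `c` only on a set of
measure at most `(∫ g) / c`. It is Hopf's lemma for `g - c`. -/
theorem measure_weightedSum_gt_le [IsFiniteMeasure m] (hV : Measurable V) (hw : Measurable w)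
    (hVw : (m.withDensity fun z => w z).map V = m) {g : Z → ℝ} (hgm : Measurable g)
    (hg : Integrable g m) (hg0 : ∀ z, 0 ≤ g z) {c : ℝ} (hc : 0 < c) :
    m {z | ∃ n, c * weightedSum V w (fun _ => 1) n z < weightedSum V w g n z}
      ≤ ENNReal.ofReal ((∫ z, g z ∂m) / c) := by
  set f : Z → ℝ := fun z => g z - c with hf
  have hfm : Measurable f := hgm.sub_const c
  have hfi : Integrable f m := hg.sub (integrable_const c)
  set E : ℕ → Set Z := fun n => {z | 0 < maxWeightedSum V w f n z} with hE
  have hEm : ∀ n, MeasurableSet (E n) := fun n =>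
    measurableSet_lt measurable_const (measurable_maxWeightedSum hV hw hfm _)
  have hmono : Monotone E := fun a b hab z (hz : 0 < _) =>
    hz.trans_le (maxWeightedSum_mono V w f z hab)
  have hsub : {z | ∃ n, c * weightedSum V w (fun _ => 1) n z < weightedSum V w g n z}
      ⊆ ⋃ n, E n := by
    rintro z ⟨n, hn⟩
    refine Set.mem_iUnion.2 ⟨n, ?_⟩
    have := weightedSum_le_maxWeightedSum V w f n z
    rw [hf, weightedSum_sub_const] at this
    change 0 < maxWeightedSum V w f n z
    exact (sub_pos.2 hn).trans_le this
  refine (measure_mono hsub).trans ?_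
  rw [hmono.measure_iUnion]
  refine iSup_le fun n => ?_
  have h0 := setIntegral_maxWeightedSum_pos_nonneg hV hw hVw hfm hfi n
  rw [hf, integral_sub hg.integrableOn (integrable_const c).integrableOn,
    setIntegral_const, smul_eq_mul] at h0
  have h1 : ∫ z in E n, g z ∂m ≤ ∫ z, g z ∂m :=
    setIntegral_le_integral hg (Eventually.of_forall hg0)
  rw [← ofReal_measureReal]
  refine ENNReal.ofReal_le_ofReal ?_
  rw [le_div_iff₀ hc]
  have h2 : 0 ≤ (∫ z in E n, g z ∂m) - m.real (E n) * c := h0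
  linarith

theorem measurable_cocycleProd (hV : Measurable V) (hw : Measurable w) (k : ℕ) :
    Measurable (cocycleProd V w k) :=
  Finset.measurable_prod _ fun i _ => hw.comp (hV.iterate i)

theorem map_withDensity_cocycleProd (hV : Measurable V) (hw : Measurable w)
    (hVw : (m.withDensity fun z => w z).map V = m) (k : ℕ) :
    (m.withDensity fun z => cocycleProd V w k z).map V^[k] = m := by
  have hL : ∀ g : Z → ℝ≥0∞, Measurable g → ∫⁻ z, w z * g (V z) ∂m = ∫⁻ z, g z ∂m := by
    intro g hg
    conv_rhs => rw [← hVw]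
    rw [lintegral_map hg hV]
    exact (lintegral_withDensity_eq_lintegral_mul _ hw.coe_nnreal_ennreal (hg.comp hV)).symm
  have hI : ∀ (k : ℕ) (g : Z → ℝ≥0∞), Measurable g →
      ∫⁻ z, cocycleProd V w k z * g (V^[k] z) ∂m = ∫⁻ z, g z ∂m := by
    intro k
    induction k with
    | zero => intro g _; simp [cocycleProd]
    | succ k ih =>
      intro g hg
      rw [← ih g hg, ← hL (fun z => cocycleProd V w k z * g (V^[k] z))
        ((measurable_cocycleProd hV hw k).coe_nnreal_ennreal.mul (hg.comp (hV.iterate k)))]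
      refine lintegral_congr fun z => ?_
      rw [cocycleProd_succ, Function.iterate_succ_apply]
      push_cast
      ring
  refine Measure.ext_of_lintegral _ fun g hg => ?_
  rw [lintegral_map hg (hV.iterate k), ← hI k g hg]
  exact lintegral_withDensity_eq_lintegral_mul _
    (measurable_cocycleProd hV hw k).coe_nnreal_ennreal (hg.comp (hV.iterate k))

end Maximal

/-! ### Radon-Nikodym derivatives along backward orbits -/

theorem power_neg_natCast {X : Type*} [MeasurableSpace X] (T : X ≃ᵐ X) (k : ℕ) :
    power T (-(k : ℤ)) = T.symm^[k] := by
  have h : ((T.toEquiv : Equiv.Perm X) ^ (-(k : ℤ)) : Equiv.Perm X)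
      = (T.symm.toEquiv : Equiv.Perm X) ^ k := by
    rw [zpow_neg, zpow_natCast, ← inv_pow]
    rfl
  rw [power, h, Equiv.Perm.coe_pow]
  rfl

/-- The Radon-Nikodym derivative `d(μ ∘ T⁻¹)/dμ`, with values in `ℝ≥0`; the points where the
derivative is infinite form a null set. -/
noncomputable def backwardWeight {X : Type*} [MeasurableSpace X] (T : X ≃ᵐ X) (μ : Measure X)
    (x : X) : ℝ≥0 :=
  ((μ.map T).rnDeriv μ x).toNNReal

section Weight

variable {X : Type*} [MeasurableSpace X] {T : X ≃ᵐ X} {μ : Measure X}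

theorem measurable_backwardWeight : Measurable (backwardWeight T μ) :=
  (Measure.measurable_rnDeriv _ _).ennreal_toNNReal

theorem map_symm_withDensity_backwardWeight [IsFiniteMeasure μ] (hT : μ.map T ≪ μ) :
    (μ.withDensity fun x => backwardWeight T μ x).map T.symm = μ := by
  have h : (μ.withDensity fun x => (backwardWeight T μ x : ℝ≥0∞)) = μ.map T := by
    rw [← Measure.withDensity_rnDeriv_eq _ _ hT]
    refine withDensity_congr_ae ?_
    filter_upwards [Measure.rnDeriv_lt_top (μ.map T) μ] with x hx
    exact ENNReal.coe_toNNReal hx.ne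
  rw [h, MeasurableEquiv.map_symm_map]

/-- The chain rule for the derivatives of `μ ∘ T⁻ᵏ`: both sides are densities of the same measure.
-/
theorem ae_derivPower_eq [IsFiniteMeasure μ] (hT : μ.map T ≪ μ) :
    ∀ᵐ x ∂μ, ∀ k : ℕ,
      derivPower T μ (-(k : ℤ)) x = cocycleProd T.symm (backwardWeight T μ) k x := by
  refine ae_all_iff.2 fun k => ?_
  have hemb : MeasurableEmbedding (T.symm^[k]) := by
    induction k with
    | zero => exact MeasurableEmbedding.id
    | succ k ih => exact ih.comp T.symm.measurableEmbedding
  have hcomap : μ.comap (power T (-(k : ℤ)))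
      = μ.withDensity fun x => (cocycleProd T.symm (backwardWeight T μ) k x : ℝ≥0∞) := by
    rw [power_neg_natCast]
    conv_lhs => rw [← map_withDensity_cocycleProd T.symm.measurable measurable_backwardWeight
      (map_symm_withDensity_backwardWeight hT) k]
    exact hemb.comap_map _
  have h := Measure.rnDeriv_withDensity μ
    (measurable_cocycleProd T.symm.measurable (measurable_backwardWeight (T := T) (μ := μ))
      k).coe_nnreal_ennreal
  filter_upwards [h] with x hx
  rw [derivPower, hcomap, hx, ENNReal.coe_toReal]

/-- If the sum of the weights is at most `M` on `A`, then `∑ k, μ (T⁻ᵏ A)` is finite, so almost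
every point visits `A` finitely often, while conservativity makes almost every point of `A` return
infinitely often. -/
theorem ae_tendsto_sum_cocycleProd_atTop [IsFiniteMeasure μ] (hT : Conservative T μ) :
    ∀ᵐ x ∂μ, Tendsto (fun n : ℕ => ∑ k ∈ Finset.range n,
      (cocycleProd T.symm (backwardWeight T μ) k x : ℝ)) atTop atTop := by
  set W := cocycleProd T.symm (backwardWeight T μ) with hW
  have hWm : ∀ k, Measurable fun x => (W k x : ℝ≥0∞) := fun k =>
    (measurable_cocycleProd T.symm.measurable measurable_backwardWeight k).coe_nnreal_ennreal
  set h : X → ℝ≥0∞ := fun x => ∑' k, (W k x : ℝ≥0∞) with hh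
  have hm : Measurable h := Measurable.tsum hWm
  have hset : ∀ M : ℕ, ∀ᵐ x ∂μ, x ∉ {x | h x ≤ M} := by
    intro M
    set A : Set X := {x | h x ≤ M} with hA
    have hAm : MeasurableSet A := measurableSet_le hm measurable_const
    have hk : ∀ k, μ (T^[k] ⁻¹' A) = ∫⁻ x in A, W k x ∂μ := by
      intro k
      have hTA : MeasurableSet (T^[k] ⁻¹' A) := (T.measurable.iterate k) hAm
      conv_lhs => rw [← map_withDensity_cocycleProd T.symm.measurable measurable_backwardWeight
        (map_symm_withDensity_backwardWeight hT.absolutelyContinuous) k]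
      rw [Measure.map_apply (T.symm.measurable.iterate k) hTA, ← Set.preimage_comp]
      have : (T^[k] ∘ T.symm^[k] : X → X) = id :=
        funext ((Function.LeftInverse.iterate T.apply_symm_apply k))
      rw [this, Set.preimage_id, withDensity_apply _ hAm]
    -- The series is the integral of `h` over `A`.
    have hsum : ∑' k, μ (T^[k] ⁻¹' A) ≠ ∞ := by
      simp_rw [hk]
      rw [← lintegral_tsum fun k => (hWm k).aemeasurable]
      refine ne_top_of_le_ne_top (b := (M : ℝ≥0∞) * μ A)
        (ENNReal.mul_ne_top (ENNReal.natCast_ne_top M) (measure_ne_top _ _)) ?_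
      rw [← setLIntegral_const]
      exact setLIntegral_mono measurable_const fun x hx => hx
    filter_upwards [ae_eventually_notMem hsum,
      hT.ae_mem_imp_frequently_image_mem hAm.nullMeasurableSet] with x h1 h2 hx
    exact h2 hx h1
  filter_upwards [ae_all_iff.2 hset] with x hx
  refine (not_summable_iff_tendsto_nat_atTop_of_nonneg fun k => NNReal.coe_nonneg _).1 fun hs => ?_
  have hne : h x ≠ ∞ := ENNReal.tsum_coe_ne_top_iff_summable.2 (NNReal.summable_coe.1 hs)
  obtain ⟨M, hM⟩ := ENNReal.exists_nat_gt hne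
  exact hx M hM.le

end Weight

theorem cocycleProd_prodMap_fst {X Y : Type*} (V : X → X) (S : Y → Y) (w : X → ℝ≥0) (k : ℕ)
    (z : X × Y) :
    cocycleProd (Prod.map V S) (fun z => w z.1) k z = cocycleProd V w k z.1 := by
  simp [cocycleProd, Prod.map_iterate]

section Product

variable {X Y : Type*} [MeasurableSpace X] [MeasurableSpace Y]

theorem map_prodMap_withDensity_fst {μ : Measure X} {ν : Measure Y} [SFinite μ] [SFinite ν]
    {V : X → X} {S : Y → Y} {w : X → ℝ≥0} (hV : Measurable V) (hw : Measurable w)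
    (hVw : (μ.withDensity fun x => w x).map V = μ) (hS : MeasurePreserving S ν ν) :
    ((μ.prod ν).withDensity fun z => w z.1).map (Prod.map V S) = μ.prod ν := by
  rw [← prod_withDensity_left (μ := μ) (ν := ν) (f := fun x => (w x : ℝ≥0∞))
    hw.coe_nnreal_ennreal, ← Measure.map_prod_map _ _ hV hS.measurable, hVw, hS.map_eq]

end Product

/-! ### Approximation of indicators by uniformly continuous functions -/

theorem exists_uniformContinuous_integral_sub_indicator_le {Z : Type*} [PseudoEMetricSpace Z]
    [MeasurableSpace Z] [BorelSpace Z] (m : Measure Z) [IsFiniteMeasure m] {B : Set Z}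
    (hB : MeasurableSet B) {ε : ℝ} (hε : 0 < ε) :
    ∃ f : Z → ℝ, UniformContinuous f ∧ (∀ z, f z ∈ Set.Icc (0 : ℝ) 1) ∧
      ∫ z, |f z - B.indicator 1 z| ∂m ≤ ε := by
  obtain ⟨F, hFB, hF, hBF⟩ := hB.exists_isClosed_sdiff_lt (measure_ne_top m B)
    (ENNReal.ofReal_pos.2 (half_pos hε)).ne'
  let δ : ℕ → ℝ := fun n => 1 / ((n : ℝ) + 1)
  have δpos : ∀ n, 0 < δ n := fun n => by positivity
  let g : ℕ → Z → ℝ := fun n z => (thickenedIndicator (δpos n) F z : ℝ)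
  have hgL : ∀ n, UniformContinuous (g n) := fun n =>
    NNReal.isUniformEmbedding_coe.uniformContinuous.comp
      (lipschitzWith_thickenedIndicator (δpos n) F).uniformContinuous
  have hg01 : ∀ n z, g n z ∈ Set.Icc (0 : ℝ) 1 := fun n z =>
    ⟨NNReal.coe_nonneg _, by exact_mod_cast thickenedIndicator_le_one (δpos n) F z⟩
  have hgm : ∀ n, Measurable (g n) := fun n => (hgL n).continuous.measurable
  have hlim : Tendsto (fun n => ∫ z, |g n z - F.indicator 1 z| ∂m) atTop (𝓝 (∫ _, 0 ∂m)) := by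
    refine tendsto_integral_of_dominated_convergence (fun _ => 1) (fun n => ?_)
      (integrable_const 1) (fun n => ae_of_all _ fun z => ?_) (ae_of_all _ fun z => ?_)
    · exact (((hgm n).sub (measurable_one.indicator hF.measurableSet)).abs).aestronglyMeasurable
    · have h1 := hg01 n z
      have h2 : F.indicator (1 : Z → ℝ) z ∈ Set.Icc (0 : ℝ) 1 := by
        by_cases hz : z ∈ F <;> simp [hz]
      rw [Real.norm_eq_abs, abs_abs, abs_le]
      constructor <;> linarith [h1.1, h1.2, h2.1, h2.2]
    · have h := tendsto_pi_nhds.1 (thickenedIndicator_tendsto_indicator_closure δpos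
        tendsto_one_div_add_atTop_nhds_zero_nat F) z
      rw [hF.closure_eq] at h
      have h' : Tendsto (fun n => g n z) atTop (𝓝 (F.indicator (1 : Z → ℝ) z)) := by
        have hval : ((F.indicator (fun _ => (1 : ℝ≥0)) z : ℝ≥0) : ℝ) = F.indicator 1 z := by
          by_cases hz : z ∈ F <;> simp [hz]
        rw [← hval]
        exact (NNReal.continuous_coe.tendsto _).comp h
      simpa using (h'.sub_const (F.indicator (1 : Z → ℝ) z)).abs
  rw [integral_zero] at hlim
  obtain ⟨n, hn⟩ := (hlim.eventually (gt_mem_nhds (half_pos hε))).exists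
  refine ⟨g n, hgL n, hg01 n, ?_⟩
  have hi1 : Integrable (fun z => |g n z - F.indicator (1 : Z → ℝ) z|) m := by
    refine Integrable.abs (Integrable.sub ?_
      ((integrable_const (1 : ℝ)).indicator hF.measurableSet))
    refine Integrable.of_bound (hgm n).aestronglyMeasurable 1 (ae_of_all _ fun z => ?_)
    rw [Real.norm_eq_abs, abs_of_nonneg (hg01 n z).1]
    exact (hg01 n z).2
  have hi2 : Integrable ((B \ F).indicator (1 : Z → ℝ)) m :=
    (integrable_const (1 : ℝ)).indicator (hB.diff hF.measurableSet)
  calc ∫ z, |g n z - B.indicator 1 z| ∂m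
      ≤ ∫ z, (|g n z - F.indicator 1 z| + (B \ F).indicator 1 z) ∂m := by
        refine integral_mono_of_nonneg (ae_of_all _ fun z => abs_nonneg _) (hi1.add hi2)
          (ae_of_all _ fun z => ?_)
        by_cases hzF : z ∈ F
        · simp [hzF, hFB hzF]
        · by_cases hzB : z ∈ B
          · simp only [Set.indicator_of_mem hzB, Set.indicator_of_notMem hzF,
              Set.indicator_of_mem (Set.mem_sdiff_of_mem hzB hzF), Pi.one_apply]
            have := abs_sub (g n z) 1
            simpa using this
          · simp [hzF, hzB]
    _ = ∫ z, |g n z - F.indicator 1 z| ∂m + m.real (B \ F) := by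
        rw [integral_add hi1 hi2, integral_indicator_one (hB.diff hF.measurableSet)]
    _ ≤ ε / 2 + ε / 2 := by
        refine add_le_add hn.le ?_
        exact ENNReal.toReal_le_of_le_ofReal (half_pos hε).le hBF.le
    _ = ε := add_halves ε

/-- Uniformly continuous approximations of an indicator all of whose weighted averages are close to
those of the indicator, at almost every point. -/
theorem exists_approx_weightedSum {Z : Type*} [PseudoEMetricSpace Z] [MeasurableSpace Z]
    [BorelSpace Z] {m : Measure Z} [IsFiniteMeasure m] {V : Z → Z} {w : Z → ℝ≥0}
    (hV : Measurable V) (hw : Measurable w) (hVw : (m.withDensity fun z => w z).map V = m)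
    {B : Set Z} (hB : MeasurableSet B) :
    ∃ f : ℕ → Z → ℝ, (∀ j, UniformContinuous (f j)) ∧ (∀ j z, f j z ∈ Set.Icc (0 : ℝ) 1) ∧
      ∀ᵐ z ∂m, ∀ᶠ j in atTop, ∀ n, weightedSum V w (fun z => |f j z - B.indicator 1 z|) n z
        ≤ (1 / 2) ^ j * weightedSum V w (fun _ => 1) n z := by
  -- With mean error `4⁻ʲ`, the maximal inequality at level `2⁻ʲ` gives a summable bound `2⁻ʲ`.
  choose f hfu hf01 hfi using fun j : ℕ => exists_uniformContinuous_integral_sub_indicator_le m hB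
    (show (0 : ℝ) < (1 / 2) ^ j * (1 / 2) ^ j by positivity)
  refine ⟨f, hfu, hf01, ?_⟩
  have hgm : ∀ j, Measurable fun z => |f j z - B.indicator 1 z| := fun j =>
    ((hfu j).continuous.measurable.sub (measurable_one.indicator hB)).abs
  have hgi : ∀ j, Integrable (fun z => |f j z - B.indicator 1 z|) m := by
    refine fun j => Integrable.of_bound (hgm j).aestronglyMeasurable 1 (ae_of_all _ fun z => ?_)
    have h1 := hf01 j z
    have h2 : B.indicator (1 : Z → ℝ) z ∈ Set.Icc (0 : ℝ) 1 := by
      by_cases hz : z ∈ B <;> simp [hz]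
    rw [Real.norm_eq_abs, abs_abs, abs_le]
    constructor <;> linarith [h1.1, h1.2, h2.1, h2.2]
  have hmeas : ∀ j : ℕ, m {z | ∃ n, (1 / 2 : ℝ) ^ j * weightedSum V w (fun _ => 1) n z
      < weightedSum V w (fun z => |f j z - B.indicator 1 z|) n z} ≤ (1 / 2 : ℝ≥0∞) ^ j := by
    intro j
    have hc : (0 : ℝ) < (1 / 2) ^ j := by positivity
    refine (measure_weightedSum_gt_le hV hw hVw (hgm j) (hgi j) (fun z => abs_nonneg _) hc).trans ?_
    have h1 : (1 / 2 : ℝ≥0∞) ^ j = ENNReal.ofReal ((1 / 2) ^ j) := by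
      rw [ENNReal.ofReal_pow (by norm_num), ENNReal.ofReal_div_of_pos (by norm_num)]
      simp
    rw [h1]
    refine ENNReal.ofReal_le_ofReal ?_
    rw [div_le_iff₀ hc]
    exact hfi j
  have hsum : ∑' j : ℕ, m {z | ∃ n, (1 / 2 : ℝ) ^ j * weightedSum V w (fun _ => 1) n z
      < weightedSum V w (fun z => |f j z - B.indicator 1 z|) n z} ≠ ∞ := by
    refine ne_top_of_le_ne_top ?_ (ENNReal.tsum_le_tsum hmeas)
    rw [ENNReal.tsum_geometric]
    simp
  filter_upwards [ae_eventually_notMem hsum] with z hz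
  filter_upwards [hz] with j hj n
  by_contra hcon
  exact hj ⟨n, not_le.1 hcon⟩

/-! ### Separation by sets that are unions of classes -/

/-- Borel sets with no `R`-related points are separated by a member of `Inv(R)`. Saturations of
Borel sets are only known to be analytic here, so Lusin separation is applied repeatedly, each time
to the saturation of the previous Borel set; the union of these sets is invariant. -/
theorem exists_isInv_separating {X : Type*} [TopologicalSpace X] [PolishSpace X]
    [MeasurableSpace X] [BorelSpace X] {R : Setoid X}
    (hR : MeasurableSet {p : X × X | R p.1 p.2}) {A A' : Set X} (hA : MeasurableSet A)
    (hA' : MeasurableSet A') (h : ∀ x ∈ A, ∀ y ∈ A', ¬ R x y) :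
    ∃ C, IsInv R C ∧ A ⊆ C ∧ Disjoint C A' := by
  set sat : Set X → Set X := fun C => {y | ∃ x ∈ C, R x y} with hsat
  have sat_analytic : ∀ C, MeasurableSet C → AnalyticSet (sat C) := by
    intro C hC
    have : sat C = Prod.snd '' ({p : X × X | R p.1 p.2} ∩ Prod.fst ⁻¹' C) := by
      ext y
      constructor
      · rintro ⟨x, hx, hxy⟩
        exact ⟨(x, y), ⟨hxy, hx⟩, rfl⟩
      · rintro ⟨⟨x, y⟩, ⟨hxy, hx⟩, rfl⟩
        exact ⟨x, hx, hxy⟩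
    rw [this]
    exact (hR.inter (measurable_fst hC)).analyticSet_image measurable_snd
  have step : ∀ C : {C : Set X // MeasurableSet C ∧ Disjoint C (sat A')},
      ∃ D : {C : Set X // MeasurableSet C ∧ Disjoint C (sat A')}, sat C ⊆ D := by
    rintro ⟨C, hC, hCA⟩
    have hdisj : Disjoint (sat C) (sat A') := by
      refine Set.disjoint_left.2 ?_
      rintro z ⟨x, hx, hxz⟩ ⟨y, hy, hyz⟩
      exact Set.disjoint_left.1 hCA hx ⟨y, hy, R.trans' hyz (R.symm' hxz)⟩
    obtain ⟨D, hD1, hD2, hD3⟩ := (sat_analytic C hC).measurablySeparable (sat_analytic A' hA') hdisj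
    exact ⟨⟨D, hD3, hD2.symm⟩, hD1⟩
  choose next hnext using step
  have hA0 : Disjoint A (sat A') := by
    refine Set.disjoint_left.2 ?_
    rintro x hx ⟨y, hy, hyx⟩
    exact h x hx y hy (R.symm' hyx)
  let C : ℕ → {C : Set X // MeasurableSet C ∧ Disjoint C (sat A')} :=
    fun n => next^[n] ⟨A, hA, hA0⟩
  have hCs : ∀ n, sat (C n) ⊆ C (n + 1) := by
    intro n
    have : C (n + 1) = next (C n) := Function.iterate_succ_apply' _ _ _
    rw [this]
    exact hnext _
  refine ⟨⋃ n, (C n : Set X), ⟨MeasurableSet.iUnion fun n => (C n).2.1, ?_⟩, ?_, ?_⟩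
  · intro x hx y hxy
    obtain ⟨n, hn⟩ := Set.mem_iUnion.1 hx
    exact Set.mem_iUnion.2 ⟨n + 1, hCs n ⟨x, hn, hxy⟩⟩
  · exact Set.subset_iUnion (fun n => (C n : Set X)) 0
  · refine Set.disjoint_iUnion_left.2 fun n => (C n).2.2.mono_right ?_
    exact fun y hy => ⟨y, hy, R.refl' y⟩

/-! ### Invariant sets of the product -/

/-- If comparable weights `W`, `W'` average asymptotic sequences `p`, `q` to values near `1` and
near `0` respectively, then `∑ W` does not diverge. -/
theorem not_tendsto_sum_of_comparable {W W' p q : ℕ → ℝ} {a ε : ℝ}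
    (hW' : ∀ k, 0 ≤ W' k) (ha : 0 ≤ a) (h1 : ∀ k, W k ≤ a * W' k) (h2 : ∀ k, W' k ≤ a * W k)
    (hp : ∀ k, p k ∈ Set.Icc (0 : ℝ) 1) (hq : ∀ k, q k ∈ Set.Icc (0 : ℝ) 1)
    (hpq : Tendsto (fun k => p k - q k) atTop (𝓝 0)) (hε : 0 < ε)
    (haε : ε * (1 + 2 * a ^ 2) < 1)
    (hp1 : ∀ n, ∑ k ∈ Finset.range n, W k * (1 - p k) ≤ ε * ∑ k ∈ Finset.range n, W k)
    (hq0 : ∀ n, ∑ k ∈ Finset.range n, W' k * q k ≤ ε * ∑ k ∈ Finset.range n, W' k) :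
    ¬ Tendsto (fun n => ∑ k ∈ Finset.range n, W k) atTop atTop := by
  intro hdiv
  obtain ⟨K, hK⟩ := eventually_atTop.1 (hpq.eventually (gt_mem_nhds hε))
  set C := ∑ k ∈ Finset.range K, W' k with hC
  have hterm : ∀ k, W' k * (p k - q k) ≤ ε * W' k + if k < K then W' k else 0 := by
    intro k
    split_ifs with hk
    · have : W' k * (p k - q k) ≤ W' k * 1 :=
        mul_le_mul_of_nonneg_left (by linarith [(hp k).2, (hq k).1]) (hW' k)
      have := mul_nonneg hε.le (hW' k)
      linarith
    · have : W' k * (p k - q k) ≤ W' k * ε :=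
        mul_le_mul_of_nonneg_left (hK k (not_lt.1 hk)).le (hW' k)
      linarith
  have hdiff : ∀ n, ∑ k ∈ Finset.range n, W' k * (p k - q k)
      ≤ ε * ∑ k ∈ Finset.range n, W' k + C := by
    intro n
    refine (Finset.sum_le_sum fun k _ => hterm k).trans ?_
    rw [Finset.sum_add_distrib, ← Finset.mul_sum, ← Finset.sum_filter]
    refine add_le_add le_rfl (Finset.sum_le_sum_of_subset_of_nonneg ?_ fun k _ _ => hW' k)
    intro k hk
    exact Finset.mem_range.2 (Finset.mem_filter.1 hk).2
  have hbound : ∀ n, (1 - ε * (1 + 2 * a ^ 2)) * ∑ k ∈ Finset.range n, W k ≤ a * C := by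
    intro n
    have e1 : ∑ k ∈ Finset.range n, W k
        = ∑ k ∈ Finset.range n, W k * (1 - p k) + ∑ k ∈ Finset.range n, W k * p k := by
      rw [← Finset.sum_add_distrib]
      exact Finset.sum_congr rfl fun k _ => by ring
    have e2 : ∑ k ∈ Finset.range n, W k * p k ≤ a * ∑ k ∈ Finset.range n, W' k * p k := by
      rw [Finset.mul_sum]
      refine Finset.sum_le_sum fun k _ => ?_
      have := mul_le_mul_of_nonneg_right (h1 k) (hp k).1
      linarith
    have e3 : ∑ k ∈ Finset.range n, W' k * p k
        = ∑ k ∈ Finset.range n, W' k * q k + ∑ k ∈ Finset.range n, W' k * (p k - q k) := by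
      rw [← Finset.sum_add_distrib]
      exact Finset.sum_congr rfl fun k _ => by ring
    have e4 : ∑ k ∈ Finset.range n, W' k ≤ a * ∑ k ∈ Finset.range n, W k := by
      rw [Finset.mul_sum]
      exact Finset.sum_le_sum fun k _ => h2 k
    have e5 : ∑ k ∈ Finset.range n, W' k * p k
        ≤ 2 * ε * (a * ∑ k ∈ Finset.range n, W k) + C := by
      have := mul_le_mul_of_nonneg_left e4 (by positivity : 0 ≤ 2 * ε)
      linarith [hq0 n, hdiff n]
    have e6 := mul_le_mul_of_nonneg_left e5 ha
    have e7 := hp1 n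
    nlinarith
  obtain ⟨n, hn⟩ := (hdiv.eventually_gt_atTop (a * C / (1 - ε * (1 + 2 * a ^ 2)))).exists
  rw [div_lt_iff₀ (sub_pos.2 haε)] at hn
  linarith [hbound n]

set_option maxHeartbeats 1600000 in
/-- The Hopf argument: off a null set, membership in an invariant subset of `X × Y` does not change
when the first coordinate is replaced by an `R`-equivalent point. -/
theorem exists_conull_forall_rel_mem {X Y : Type*} [MetricSpace X] [SecondCountableTopology X]
    [MeasurableSpace X] [BorelSpace X] [MetricSpace Y] [SecondCountableTopology Y]
    [MeasurableSpace Y] [BorelSpace Y] {μ : Measure X} {ν : Measure Y} [IsFiniteMeasure μ]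
    [IsFiniteMeasure ν] {T : X ≃ᵐ X} {S : Y ≃ᵐ Y} {R : Setoid X} (hcons : Conservative T μ)
    (hS : MeasurePreserving S ν ν) (hsquash : Squashes T R μ) (hbdd : IsBackwardBounded T R μ)
    {B : Set (X × Y)} (hB : MeasurableSet B) (hBinv : Prod.map T S ⁻¹' B = B) :
    ∃ Z : Set (X × Y), MeasurableSet Z ∧ μ.prod ν Zᶜ = 0 ∧
      ∀ x x' y, (x, y) ∈ Z → (x', y) ∈ Z → R x x' → (x, y) ∈ B → (x', y) ∈ B := by
  obtain ⟨X₁, hX₁, hsq⟩ := hsquash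
  obtain ⟨α, X₀, -, hα1, -, hX₀, hα⟩ := hbdd
  set w := backwardWeight T μ with hw
  set W : ℕ → X → ℝ := fun k x => cocycleProd T.symm w k x with hW
  set V : X × Y → X × Y := Prod.map T.symm S.symm with hV
  have hwm : Measurable w := measurable_backwardWeight
  have hVm : Measurable V := T.symm.measurable.prodMap S.symm.measurable
  have hwV := map_prodMap_withDensity_fst (ν := ν) T.symm.measurable hwm
    (map_symm_withDensity_backwardWeight hcons.absolutelyContinuous) (hS.symm S)
  obtain ⟨f, hfu, hf01, hfB⟩ :=
    exists_approx_weightedSum (m := μ.prod ν) hVm (w := fun z => w z.1)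
      (hwm.comp measurable_fst) hwV hB
  have hVB : ∀ k z, V^[k] z ∈ B ↔ z ∈ B := by
    have h1 : ∀ z, V z ∈ B ↔ z ∈ B := by
      intro z
      conv_lhs => rw [← hBinv]
      rw [Set.mem_preimage, hV]
      simp only [Prod.map_apply', MeasurableEquiv.apply_symm_apply, Prod.mk.eta]
    intro k z
    induction k with
    | zero => rfl
    | succ k ih => rw [Function.iterate_succ_apply', h1, ih]
  have hgood : ∀ᵐ x ∂μ, (x ∈ X₁ ∧ x ∈ X₀) ∧ (∀ k : ℕ, derivPower T μ (-(k : ℤ)) x = W k x) ∧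
      Tendsto (fun n : ℕ => ∑ k ∈ Finset.range n, W k x) atTop atTop := by
    filter_upwards [compl_mem_ae_iff.2 hX₁, compl_mem_ae_iff.2 hX₀,
      ae_derivPower_eq hcons.absolutelyContinuous, ae_tendsto_sum_cocycleProd_atTop hcons]
      with x h1 h0 h2 h3
    exact ⟨⟨not_not.1 h1, not_not.1 h0⟩, h2, h3⟩
  have hP := ((Measure.quasiMeasurePreserving_fst (μ := μ) (ν := ν)).ae hgood).and hfB
  obtain ⟨N, hPN, hN, hN0⟩ := exists_measurable_superset_of_null (ae_iff.1 hP)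
  refine ⟨Nᶜ, hN.compl, by rwa [compl_compl], ?_⟩
  intro x x' y hx hx' hxx' hxB
  by_contra hx'B
  obtain ⟨⟨⟨hx1, hx0⟩, hxd, hxdiv⟩, hxf⟩ :=
    not_not.1 fun h => hx (hPN h)
  obtain ⟨⟨⟨hx1', hx0'⟩, hxd', -⟩, hxf'⟩ :=
    not_not.1 fun h => hx' (hPN h)
  dsimp only at hx1 hx0 hxd hxdiv hx1' hx0' hxd'
  set a := α ⟨(x, x'), hxx'⟩ with ha
  have ha1 : 1 ≤ a := hα1 _
  have ha0 : 0 < a := one_pos.trans_le ha1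
  have hcomp : ∀ k, W k x ≤ a * W k x' ∧ W k x' ≤ a * W k x := by
    intro k
    obtain ⟨h1, h2⟩ := hα x hx0 x' hx0' hxx' k
    rw [hxd, hxd', ← ha] at h1 h2
    -- The strict lower bound rules out `W k x' = 0`, where the quotient would be `0`.
    have hpos : 0 < W k x / W k x' := (inv_pos.2 ha0).trans h1
    have hW' : 0 < W k x' := by
      refine lt_of_le_of_ne (NNReal.coe_nonneg _) fun h => ?_
      rw [← h, div_zero] at hpos
      exact hpos.false
    rw [div_lt_iff₀ hW'] at h2
    rw [lt_div_iff₀ hW', inv_mul_lt_iff₀ ha0] at h1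
    exact ⟨h2.le, h1.le⟩
  have hsmall : Tendsto (fun j : ℕ => (1 / 2 : ℝ) ^ j * (1 + 2 * a ^ 2)) atTop (𝓝 0) := by
    simpa using (tendsto_pow_atTop_nhds_zero_of_lt_one (by norm_num)
      (by norm_num : (1 / 2 : ℝ) < 1)).mul_const (1 + 2 * a ^ 2)
  obtain ⟨j, ⟨hj, hj'⟩, hja⟩ :=
    ((hxf.and hxf').and (hsmall.eventually (gt_mem_nhds one_pos))).exists
  simp only [weightedSum, cocycleProd_prodMap_fst, hV, mul_one] at hj hj'
  rw [← hV] at hj hj'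
  have hpq : Tendsto (fun k : ℕ => f j (V^[k] (x, y)) - f j (V^[k] (x', y))) atTop (𝓝 0) := by
    have hd : Tendsto (fun k : ℕ => dist (V^[k] (x, y)) (V^[k] (x', y))) atTop (𝓝 0) := by
      have hinj : Function.Injective fun k : ℕ => -(k : ℤ) :=
        neg_injective.comp Nat.cast_injective
      have h := (hsq x hx1 x' hx1' hxx').comp hinj.tendsto_cofinite
      rw [Nat.cofinite_eq_atTop] at h
      refine h.congr fun k => ?_
      simp only [Function.comp_apply, power_neg_natCast, hV, Prod.map_iterate, Prod.map_apply,
        Prod.dist_eq, dist_self]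
      exact (max_eq_left dist_nonneg).symm
    rw [Metric.tendsto_nhds]
    intro ε hε
    obtain ⟨δ, hδ, hfδ⟩ := Metric.uniformContinuous_iff.1 (hfu j) ε hε
    filter_upwards [hd.eventually (gt_mem_nhds hδ)] with k hk
    rw [dist_zero_right, ← dist_eq_norm]
    exact hfδ hk
  refine not_tendsto_sum_of_comparable (W := fun k => W k x) (W' := fun k => W k x')
    (p := fun k => f j (V^[k] (x, y))) (q := fun k => f j (V^[k] (x', y)))
    (fun k => NNReal.coe_nonneg _) ha0.le (fun k => (hcomp k).1) (fun k => (hcomp k).2)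
    (fun k => hf01 j _) (fun k => hf01 j _) hpq (ε := (1 / 2) ^ j) (by positivity) hja
    (fun n => ?_) (fun n => ?_) hxdiv
  · refine le_trans (Finset.sum_le_sum fun k _ => ?_) (hj n)
    rw [Set.indicator_of_mem ((hVB k _).2 hxB), Pi.one_apply, abs_sub_comm]
    exact mul_le_mul_of_nonneg_left (le_abs_self _) (NNReal.coe_nonneg _)
  · refine le_trans (Finset.sum_le_sum fun k _ => ?_) (hj' n)
    rw [Set.indicator_of_notMem (mt (hVB k _).1 hx'B), sub_zero]
    exact mul_le_mul_of_nonneg_left (le_abs_self _) (NNReal.coe_nonneg _)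

theorem ae_fiber_ae_eq_isInv {X Y : Type*} [MetricSpace X] [PolishSpace X]
    [MeasurableSpace X] [BorelSpace X] [MeasurableSpace Y] [StandardBorelSpace Y]
    {μ : Measure X} {ν : Measure Y} [IsFiniteMeasure μ]
    [IsFiniteMeasure ν] {T : X ≃ᵐ X} {S : Y ≃ᵐ Y} {R : Setoid X} (hcons : Conservative T μ)
    (hS : MeasurePreserving S ν ν) (hR : MeasurableSet {p : X × X | R p.1 p.2})
    (hsquash : Squashes T R μ) (hbdd : IsBackwardBounded T R μ)
    {B : Set (X × Y)} (hB : MeasurableSet B) (hBinv : Prod.map T S ⁻¹' B = B) :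
    ∀ᵐ y ∂ν, ∃ C, IsInv R C ∧ {x | (x, y) ∈ B} =ᵐ[μ] C := by
  let _ := upgradeStandardBorel Y
  let _ := TopologicalSpace.upgradeIsCompletelyMetrizable Y
  obtain ⟨Z, hZ, hZ0, hZB⟩ :=
    exists_conull_forall_rel_mem hcons hS hsquash hbdd hB hBinv
  have hZae : ∀ᵐ z ∂μ.prod ν, z ∈ Z := by rwa [ae_iff]
  have hZy : ∀ᵐ y ∂ν, ∀ᵐ x ∂μ, (x, y) ∈ Z :=
    Measure.ae_ae_of_ae_prod (Measure.measurePreserving_swap.quasiMeasurePreserving.ae hZae)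
  filter_upwards [hZy] with y hy
  have hBy : MeasurableSet {x | (x, y) ∈ B} := measurable_prodMk_right hB
  have hZym : MeasurableSet {x | (x, y) ∈ Z} := measurable_prodMk_right hZ
  obtain ⟨C, hC, hAC, hCA⟩ := exists_isInv_separating hR (hZym.inter hBy) (hZym.diff hBy)
    fun x hx x' hx' hxx' => hx'.2 (hZB x x' y hx.1 hx'.1 hxx' hx.2)
  refine ⟨C, hC, ?_⟩
  filter_upwards [hy] with x hx
  refine propext ⟨fun hxB => hAC ⟨hx, hxB⟩, fun hxC => ?_⟩
  by_contra hxB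
  exact Set.disjoint_left.1 hCA hxC ⟨hx, hxB⟩

/-! ### Ergodicity and weak mixing -/

theorem IsInv.limsup_preimage {X : Type*} [MeasurableSpace X] {T : X ≃ᵐ X} {R : Setoid X}
    (hnorm : Normalizes T R) {C : Set X} (hC : IsInv R C) :
    IsInv R (limsup (fun n => (Set.preimage T)^[n] C) atTop) := by
  have hTR : ∀ n x y, R x y → R (T^[n] x) (T^[n] y) := by
    intro n x y hxy
    induction n with
    | zero => exact hxy
    | succ n ih =>
      rw [Function.iterate_succ_apply', Function.iterate_succ_apply']
      exact (hnorm (T^[n] x)).subset ⟨_, ih, rfl⟩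
  refine ⟨MeasurableSet.measurableSet_limsup fun n => ?_, fun x hx y hxy => ?_⟩
  · rw [← Set.preimage_iterate_eq]
    exact (T.measurable.iterate n) hC.1
  · rw [mem_limsup_iff_frequently_mem] at hx ⊢
    refine hx.mono fun n hn => ?_
    rw [← Set.preimage_iterate_eq] at hn ⊢
    exact hC.2 _ hn _ (hTR n x y hxy)

theorem quasiErgodic_of_isErgodicOnInv {X : Type*} [MetricSpace X] [PolishSpace X]
    [MeasurableSpace X] [BorelSpace X] {μ : Measure X} [IsFiniteMeasure μ]
    {T : X ≃ᵐ X} {R : Setoid X} (hcons : Conservative T μ)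
    (hR : MeasurableSet {p : X × X | R p.1 p.2}) (hnorm : Normalizes T R)
    (hinv : IsErgodicOnInv T R μ) (hsquash : Squashes T R μ) (hbdd : IsBackwardBounded T R μ) :
    QuasiErgodic T μ := by
  have hq := hcons.toQuasiMeasurePreserving
  refine ⟨hq, ⟨fun B hB hTB => ?_⟩⟩
  have hBinv : Prod.map T (MeasurableEquiv.refl Unit) ⁻¹' (Prod.fst ⁻¹' B) = Prod.fst ⁻¹' B := by
    conv_rhs => rw [← hTB]
    rfl
  have h := ae_fiber_ae_eq_isInv (ν := Measure.dirac ()) hcons (MeasurePreserving.id _) hR hsquash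
    hbdd (measurable_fst hB) hBinv
  rw [ae_dirac_eq] at h
  obtain ⟨C, hC, hBC : B =ᵐ[μ] C⟩ := eventually_pure.1 h
  have hTC : T ⁻¹' C =ᵐ[μ] C :=
    (hq.preimage_ae_eq hBC.symm).trans (by rwa [hTB])
  -- The points whose forward orbit visits `C` infinitely often form a strictly `T`-invariant set.
  set D := limsup (α := Set X) (fun n => (Set.preimage T)^[n] C) atTop with hD
  have hBD : B =ᵐ[μ] D := hBC.trans (hq.limsup_preimage_iterate_ae_eq hTC).symm
  have hTD : T ⁻¹' D = D :=
    CompleteLatticeHom.apply_limsup_iterate (CompleteLatticeHom.setPreimage T) C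
  rw [eventuallyConst_set']
  rcases hinv D (hC.limsup_preimage hnorm) hTD with h0 | h0
  · exact Or.inl (hBD.trans (ae_eq_empty.2 h0))
  · exact Or.inr (hBD.trans (ae_eq_univ.2 h0))

theorem isWeaklyMixing_of_isErgodicRel {X : Type u} [MetricSpace X] [PolishSpace X]
    [MeasurableSpace X] [BorelSpace X] {μ : Measure X} [IsFiniteMeasure μ]
    {T : X ≃ᵐ X} {R : Setoid X} (hT : IsNonsingular T μ) (hcons : Conservative T μ)
    (hR : MeasurableSet {p : X × X | R p.1 p.2}) (herg : IsErgodicRel R μ)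
    (hsquash : Squashes T R μ) (hbdd : IsBackwardBounded T R μ) :
    IsWeaklyMixing.{u, v} T μ := by
  intro Y _ _ ν _ S hS
  have hq := hcons.toQuasiMeasurePreserving
  have hpre : ∀ A, μ (T ⁻¹' A) = 0 ↔ μ A = 0 := by
    intro A
    refine ⟨fun h => ?_, fun h => hq.preimage_null h⟩
    have h1 : μ.comap T (T ⁻¹' A) = 0 := hT.1 h
    rwa [← T.symm_symm, T.symm.comap_symm, T.symm.map_apply, T.symm_symm, ← Set.preimage_comp,
      T.self_comp_symm, Set.preimage_id] at h1
  refine ⟨MeasureTheory.QuasiMeasurePreserving.prodMap hq hS.quasiMeasurePreserving,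
    ⟨fun B hB hTB => ?_⟩⟩
  have hfib : ∀ᵐ y ∂ν, μ {x | (x, y) ∈ B} = 0 ∨ μ {x | (x, y) ∈ B}ᶜ = 0 := by
    filter_upwards [ae_fiber_ae_eq_isInv hcons hS.toMeasurePreserving hR hsquash hbdd hB hTB]
      with y ⟨C, hC, hBC⟩
    rcases herg C hC with h0 | h0
    · exact Or.inl ((measure_congr hBC).trans h0)
    · exact Or.inr ((measure_congr hBC.compl).trans h0)
  have hm : Measurable fun y => μ {x | (x, y) ∈ B} := measurable_measure_prodMk_right hB
  set D : Set Y := {y | μ {x | (x, y) ∈ B} = 0} with hD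
  have hDm : MeasurableSet D := hm (measurableSet_singleton 0)
  have hSD : S ⁻¹' D = D := by
    ext y
    have h1 : {x | (x, y) ∈ B} = T ⁻¹' {x | (x, S y) ∈ B} := by
      conv_lhs => rw [← hTB]
      rfl
    change μ {x | (x, S y) ∈ B} = 0 ↔ μ {x | (x, y) ∈ B} = 0
    rw [h1, hpre]
  rw [eventuallyConst_set', ae_eq_empty, ae_eq_univ, Measure.prod_apply_symm hB,
    Measure.prod_apply_symm hB.compl, lintegral_eq_zero_iff (measurable_measure_prodMk_right hB),
    lintegral_eq_zero_iff (measurable_measure_prodMk_right hB.compl)]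
  rcases hS.toPreErgodic.ae_mem_or_ae_notMem hDm hSD with h | h
  · exact Or.inl h
  · refine Or.inr ?_
    filter_upwards [h, hfib] with y hy1 hy2
    exact hy2.resolve_left hy1

end NonsingularDynamics

theorem theorem3p1 {X : Type u} [MetricSpace X] [IsUltrametricDist X] [PolishSpace X]
    [MeasurableSpace X] [BorelSpace X] (μ : Measure X) [IsProbabilityMeasure μ]
    (T : X ≃ᵐ X) (R : Setoid X)
    (hT : NonsingularDynamics.IsNonsingular T μ) (hcons : Conservative T μ)
    (hR : NonsingularDynamics.IsCountableBorel R)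
    (hnorm : NonsingularDynamics.Normalizes T R)
    (hinv : NonsingularDynamics.IsErgodicOnInv T R μ)
    (houter : NonsingularDynamics.IsStrictlyOuter T R μ)
    (hsquash : NonsingularDynamics.Squashes T R μ)
    (hbdd : NonsingularDynamics.IsBackwardBounded T R μ) :
    QuasiErgodic T μ ∧
      (NonsingularDynamics.IsErgodicRel R μ →
        NonsingularDynamics.IsWeaklyMixing.{u, v} T μ) := by
  have hRm := hR.measurableSet_graph
  exact ⟨NonsingularDynamics.quasiErgodic_of_isErgodicOnInv hcons hRm hnorm hinv hsquash hbdd,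
    fun herg => NonsingularDynamics.isWeaklyMixing_of_isErgodicRel hT hcons hRm herg hsquash hbdd⟩
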